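/- Let $\mathbb F$ be a field. An arithmetic circuit over $\mathbb F$ in variables $x_1,\dots,x_n$ is a finite directed acyclic graph in which every vertex (gate) has in-degree $0$ or $2$; gates of in-degree $0$ are labelled by a variable or a constant from $\mathbb F$, all other gates are labelled by $+$ or $\times$, and each wire carries a scalar of $\mathbb F$ by which it multiplies the polynomial it transports. Each gate computes a polynomial in the natural way. The size of a circuit is its number of gates (input gates included). A formula is a circuit whose underlying undirected graph is a tree (two parallel wires count as a cycle) with a single gate of out-degree $0$, which computes its output; $L(f)$ denotes the minimum size of a formula computing $f$. A multi-output formula is a circuit whose underlying undirected graph has no cycles (gates may have fan-out greater than $1$, and the graph need not be connected); it computes $f_1,\dots,f_k$ if each $f_i$ is computed at some gate, and $L(f_1,\dots,f_k)$ denotes the minimum size of a multi-output formula computing $f_1,\dots,f_k$. **Corollary.** Over any infinite field $\mathbb F$ there is a family $\{f_n\}_{n\ge 1}$ of polynomials $f_n\in\mathbb F[x_1,\dots,x_n]$ such that $$L(f_n)=n^{1+o(1)}\qquad\text{but}\qquad L\big(\partial_{x_1}f_n,\dots,\partial_{x_n}f_n\big)=\Omega\!\left(\frac{n^2}{\log n}\right).$$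 Consequently, the analogue of the Baur–Strassen theorem fails for formulas: over $\mathbb F$ there is no constant $K$ such that $L(\partial_{x_1}g,\dots,\partial_{x_n}g)\le K\cdot L(g)$ for all $n$ and all $g\in\mathbb F[x_1,\dots,x_n]$. -/

import Mathlib

open Filter Topology

universe u v

/-- What a gate of an arithmetic circuit is labelled with, together with its incoming wires.
An input gate is a variable or a field constant; `add a x b y` and `mul a x b y` are gates of
in-degree two, with a wire from gate `x` scaled by the field element `a` and a wire from gate `y`
scaled by the field element `b`. -/
inductive GateLabel (F : Type u) (σ : Type v) (V : Type) where
  | var (i : σ)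
  | const (c : F)
  | add (a : F) (x : V) (b : F) (y : V)
  | mul (a : F) (x : V) (b : F) (y : V)

/-- The gates from which the incoming wires start, one entry per wire. -/
def GateLabel.sources {F : Type u} {σ : Type v} {V : Type} : GateLabel F σ V → List V
  | .var _ => []
  | .const _ => []
  | .add _ x _ y => [x, y]
  | .mul _ x _ y => [x, y]

/-- An arithmetic circuit over `F` with variables indexed by `σ`: a finite directed acyclic graph
of gates of in-degree zero or two.  As there are finitely many gates, well-foundedness of the wire
relation says exactly that there is no directed cycle. -/
structure ArithCircuit (F : Type u) (σ : Type v) where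
  Gate : Type
  fintypeGate : Fintype Gate
  label : Gate → GateLabel F σ Gate
  acyclic : WellFounded fun x z : Gate => x ∈ (label z).sources

namespace ArithCircuit

variable {F : Type u} {σ : Type v}

/-- There is a wire from gate `x` to gate `z`. -/
def Wire (Φ : ArithCircuit F σ) (x z : Φ.Gate) : Prop := x ∈ (Φ.label z).sources

/-- The size of a circuit: the number of all its gates, input gates included. -/
def size (Φ : ArithCircuit F σ) : ℕ := @Fintype.card Φ.Gate Φ.fintypeGate

/-- The polynomial computed at a gate. -/
noncomputable def poly [CommSemiring F] (Φ : ArithCircuit F σ) : Φ.Gate → MvPolynomial σ F :=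
  Φ.acyclic.fix fun z rec =>
    match h : Φ.label z with
    | .var i => MvPolynomial.X i
    | .const c => MvPolynomial.C c
    | .add a x b y =>
        MvPolynomial.C a * rec x (by simp [h, GateLabel.sources]) +
          MvPolynomial.C b * rec y (by simp [h, GateLabel.sources])
    | .mul a x b y =>
        (MvPolynomial.C a * rec x (by simp [h, GateLabel.sources])) *
          (MvPolynomial.C b * rec y (by simp [h, GateLabel.sources]))

/-- The recursive description of the polynomial computed at a gate. -/
theorem poly_eq [CommSemiring F] (Φ : ArithCircuit F σ) (z : Φ.Gate) :
    Φ.poly z =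
      match Φ.label z with
      | .var i => MvPolynomial.X i
      | .const c => MvPolynomial.C c
      | .add a x b y => MvPolynomial.C a * Φ.poly x + MvPolynomial.C b * Φ.poly y
      | .mul a x b y => (MvPolynomial.C a * Φ.poly x) * (MvPolynomial.C b * Φ.poly y) := by
  rw [poly, WellFounded.fix_eq]
  split <;> rename_i h <;> simp [h]

/-- An output gate is a gate of out-degree zero. -/
def IsOutput (Φ : ArithCircuit F σ) (z : Φ.Gate) : Prop := ∀ w, ¬ Φ.Wire z w

/-- The simple graph underlying a circuit: directions are forgotten, and parallel wires merged. -/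
def graph (Φ : ArithCircuit F σ) : SimpleGraph Φ.Gate := SimpleGraph.fromRel Φ.Wire

/-- No two wires have the same start and the same end.  A pair of parallel wires would be a cycle of
length two in the underlying undirected (multi)graph. -/
def NoParallelWires (Φ : ArithCircuit F σ) : Prop := ∀ z, (Φ.label z).sources.Nodup

/-- A (single-output) formula: the underlying undirected graph is a tree, and there is exactly one
output gate; `Φ.IsFormulaFor f` says moreover that `f` is computed there. -/
def IsFormulaFor [CommSemiring F] (Φ : ArithCircuit F σ) (f : MvPolynomial σ F) : Prop :=
  Φ.NoParallelWires ∧ Φ.graph.IsTree ∧ ∃ r, (∀ z, Φ.IsOutput z ↔ z = r) ∧ Φ.poly r = f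

/-- A multi-output formula computing the family `f`: the underlying undirected graph has no cycle
(fan-out greater than one is allowed, and the graph need not be connected), and every member of the
family is computed at some gate, which need not be an output gate. -/
def IsMultiFormulaFor [CommSemiring F] (Φ : ArithCircuit F σ) {ι : Type*}
    (f : ι → MvPolynomial σ F) : Prop :=
  Φ.NoParallelWires ∧ Φ.graph.IsAcyclic ∧ ∀ i, ∃ z, Φ.poly z = f i

end ArithCircuit

/-- The size of the smallest formula that computes `f`. -/
noncomputable def formulaSize {F : Type u} {σ : Type v} [CommSemiring F]
    (f : MvPolynomial σ F) : ℕ :=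
  sInf {s : ℕ | ∃ Φ : ArithCircuit F σ, Φ.IsFormulaFor f ∧ Φ.size = s}

/-- The size of the smallest multi-output formula that computes all members of the family `f`. -/
noncomputable def multiFormulaSize {F : Type u} {σ : Type v} [CommSemiring F] {ι : Type*}
    (f : ι → MvPolynomial σ F) : ℕ :=
  sInf {s : ℕ | ∃ Φ : ArithCircuit F σ, Φ.IsMultiFormulaFor f ∧ Φ.size = s}

/-!
The family is `f = (∑ xᵢ) (∑ (xᵢ² + xᵢ³))`. It is computed by the obvious formula of linear size
(`formulaSize_sumProduct_le`) and depends on all its variables, so its formula size is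
`n ^ (1 + o(1))`. With `βᵢ = 2 xᵢ + 3 xᵢ²`, the mixed second derivatives are `∂ₖ∂ᵢf = βₖ + βᵢ` for `k ≠ i`.
Hence for `i ≠ j` the gradients of `∂ᵢf` and `∂ⱼf` have the minor `(βₖ - βₗ) (βⱼ - βᵢ)` in any two
coordinates `k ≠ l` other than `i, j`. It is nonzero in every characteristic, because `2` and `3`
do not both vanish. So these gradients do not become parallel when fewer than about `n`
coordinates are dropped (`not_gradients_parallel`).

In a multi-output formula, descend from the gate computing `∂ᵢf`, always to the child whose
polynomial involves more variables. At each step the gradient changes by a factor only, except in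
the coordinates of the variables that occur at the other child; their number is the merge cost of
the gate (`exists_heavy_child`). Stop the descent as soon as the total merge cost exceeds `D`, a
constant fraction of `n` (`exists_descending_path`). If the paths for `∂ᵢf` and `∂ⱼf` had a gate
in common, both gradients would be parallel to the gradient at that gate outside `2 D`
coordinates, so the `n` paths are pairwise disjoint, and the sum of all merge costs exceeds `n D`.

On the other hand, the underlying graph is a forest, so a gate joins two parts that were
disconnected before it was added, and each variable seen at a child labels an input gate of that
child's part. The merge cost is at most the size of the smaller part, and by the small-to-large
argument all merge costs of a formula with `s` gates add up to at most `s log₂ s`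
(`IsSubcircuit.sum_mergeCost_le`). Therefore `s log s` is at least of order `n²`, and `s` of order
`n² / log n`.
-/

open MvPolynomial

namespace ArithCircuit

section LowerBound

/-! ### Ranks, gradients and variables along wires -/

variable {F : Type u} {σ : Type v}

/-- The height of a gate in the wire relation, an ordinal that strictly increases along wires. -/
noncomputable def rank (Φ : ArithCircuit F σ) (z : Φ.Gate) : Ordinal :=
  (Φ.acyclic.apply z).rank

theorem rank_lt_of_wire (Φ : ArithCircuit F σ) {x z : Φ.Gate} (h : Φ.Wire x z) :
    Φ.rank x < Φ.rank z :=
  Acc.rank_lt_of_rel (Φ.acyclic.apply z) h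

theorem Wire.ne {Φ : ArithCircuit F σ} {x z : Φ.Gate} (h : Φ.Wire x z) : x ≠ z := by
  rintro rfl
  exact lt_irrefl _ (Φ.rank_lt_of_wire h)

theorem Wire.graph_adj {Φ : ArithCircuit F σ} {x z : Φ.Gate} (h : Φ.Wire x z) :
    Φ.graph.Adj x z :=
  (SimpleGraph.fromRel_adj _ _ _).2 ⟨h.ne, Or.inl h⟩

theorem sources_eq_nil_or_pair (Φ : ArithCircuit F σ) (z : Φ.Gate) :
    (Φ.label z).sources = [] ∨ ∃ x y, (Φ.label z).sources = [x, y] := by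
  cases Φ.label z <;> simp [GateLabel.sources]

/-- A set of gates that contains, with each of its members, the gates from which that member's wires
come. -/
def IsSubcircuit (Φ : ArithCircuit F σ) (W : Finset Φ.Gate) : Prop :=
  ∀ z ∈ W, ∀ x, Φ.Wire x z → x ∈ W

/-- In a forest, removing a gate that feeds no other gate of a subcircuit separates its two
children: what remains splits into two disjoint subcircuits, each with one of the children. -/
theorem IsSubcircuit.exists_split {Φ : ArithCircuit F σ} (hpar : Φ.NoParallelWires)
    (hac : Φ.graph.IsAcyclic) {W : Finset Φ.Gate} (hW : Φ.IsSubcircuit W) {w x y : Φ.Gate}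
    (hw : w ∈ W) (hmax : ∀ z ∈ W, ¬ Φ.Wire w z) (h : (Φ.label w).sources = [x, y]) :
    ∃ A B : Finset Φ.Gate, Φ.IsSubcircuit A ∧ Φ.IsSubcircuit B ∧ x ∈ A ∧ y ∈ B ∧
      Disjoint A B ∧ w ∉ A ∧ w ∉ B ∧ ∀ z, z ∈ W ↔ z = w ∨ z ∈ A ∨ z ∈ B := by
  classical
  have hx : Φ.Wire x w := by simp [Wire, h]
  have hy : Φ.Wire y w := by simp [Wire, h]
  have hxy : x ≠ y := by have := hpar w; rw [h] at this; simpa using this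
  -- The two parts are told apart by reachability from `x` after the edge `x w` is deleted. This
  -- edge is a bridge, and `y` is still joined to `w`, so `y` is not reachable.
  set G := Φ.graph.deleteEdges {s(x, w)} with hG
  have hbridge : ¬ G.Reachable x w :=
    SimpleGraph.isBridge_iff.1 (SimpleGraph.isAcyclic_iff_forall_adj_isBridge.1 hac hx.graph_adj)
  have hadj : ∀ {a b : Φ.Gate}, Φ.Wire a b → s(a, b) ≠ s(x, w) → G.Adj a b := by
    intro a b hab hne
    rw [hG, SimpleGraph.deleteEdges_adj]
    exact ⟨hab.graph_adj, by simpa using hne⟩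
  have hyw : G.Adj y w := hadj hy (by
    intro he
    rcases Sym2.eq_iff.1 he with ⟨h1, -⟩ | ⟨h1, -⟩
    · exact hxy h1.symm
    · exact hy.ne h1)
  have hnw : ∀ {a b : Φ.Gate}, a ≠ w → b ≠ w → s(a, b) ≠ s(x, w) := by
    intro a b ha hb he
    rcases Sym2.eq_iff.1 he with ⟨-, h1⟩ | ⟨h1, -⟩
    · exact hb h1
    · exact ha h1
  refine ⟨(W.erase w).filter fun z => G.Reachable x z,
    (W.erase w).filter fun z => ¬ G.Reachable x z, ?_, ?_, ?_, ?_, ?_, ?_, ?_, ?_⟩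
  · intro z hz a ha
    simp only [Finset.mem_filter, Finset.mem_erase] at hz ⊢
    have haw : a ≠ w := fun e => hmax z hz.1.2 (e ▸ ha)
    exact ⟨⟨haw, hW z hz.1.2 a ha⟩, hz.2.trans (hadj ha (hnw haw hz.1.1)).symm.reachable⟩
  · intro z hz a ha
    simp only [Finset.mem_filter, Finset.mem_erase] at hz ⊢
    have haw : a ≠ w := fun e => hmax z hz.1.2 (e ▸ ha)
    exact ⟨⟨haw, hW z hz.1.2 a ha⟩, fun hr =>
      hz.2 (hr.trans (hadj ha (hnw haw hz.1.1)).reachable)⟩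
  · simp only [Finset.mem_filter, Finset.mem_erase]
    exact ⟨⟨hx.ne, hW w hw x hx⟩, SimpleGraph.Reachable.refl _⟩
  · simp only [Finset.mem_filter, Finset.mem_erase]
    exact ⟨⟨hy.ne, hW w hw y hy⟩, fun hr => hbridge (hr.trans hyw.reachable)⟩
  · exact Finset.disjoint_filter_filter_not _ _ _
  · simp
  · simp
  · intro z
    simp only [Finset.mem_filter, Finset.mem_erase]
    by_cases hzw : z = w
    · simp [hzw, hw]
    · by_cases hr : G.Reachable x z <;> simp [hzw, hr]

variable [CommSemiring F]

/-- At a gate with incoming wires from `x` and `y`, differentiation in a variable that does not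
occur at `y` only sees `x`, up to a factor that does not depend on the variable. -/
theorem exists_pderiv_poly_eq_left (Φ : ArithCircuit F σ) {z x y : Φ.Gate}
    (h : (Φ.label z).sources = [x, y]) :
    ∃ Q, ∀ k ∉ (Φ.poly y).vars, pderiv k (Φ.poly z) = Q * pderiv k (Φ.poly x) := by
  rw [Φ.poly_eq z]
  cases hz : Φ.label z with
  | var i => simp [hz, GateLabel.sources] at h
  | const c => simp [hz, GateLabel.sources] at h
  | add a x' b y' =>
    obtain ⟨rfl, rfl⟩ : x' = x ∧ y' = y := by simpa [hz, GateLabel.sources] using h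
    exact ⟨C a, fun k hk => by simp [pderiv_eq_zero_of_notMem_vars hk]⟩
  | mul a x' b y' =>
    obtain ⟨rfl, rfl⟩ : x' = x ∧ y' = y := by simpa [hz, GateLabel.sources] using h
    exact ⟨C a * (C b * Φ.poly y'), fun k hk => by
      simp [pderiv_eq_zero_of_notMem_vars hk]; ring⟩

theorem exists_pderiv_poly_eq_right (Φ : ArithCircuit F σ) {z x y : Φ.Gate}
    (h : (Φ.label z).sources = [x, y]) :
    ∃ Q, ∀ k ∉ (Φ.poly x).vars, pderiv k (Φ.poly z) = Q * pderiv k (Φ.poly y) := by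
  rw [Φ.poly_eq z]
  cases hz : Φ.label z with
  | var i => simp [hz, GateLabel.sources] at h
  | const c => simp [hz, GateLabel.sources] at h
  | add a x' b y' =>
    obtain ⟨rfl, rfl⟩ : x' = x ∧ y' = y := by simpa [hz, GateLabel.sources] using h
    exact ⟨C b, fun k hk => by simp [pderiv_eq_zero_of_notMem_vars hk]⟩
  | mul a x' b y' =>
    obtain ⟨rfl, rfl⟩ : x' = x ∧ y' = y := by simpa [hz, GateLabel.sources] using h
    exact ⟨C a * Φ.poly x' * C b, fun k hk => by
      simp [pderiv_eq_zero_of_notMem_vars hk]; ring⟩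

theorem mem_vars_or_mem_vars (Φ : ArithCircuit F σ) {z x y : Φ.Gate}
    (h : (Φ.label z).sources = [x, y]) {i : σ} (hi : i ∈ (Φ.poly z).vars) :
    i ∈ (Φ.poly x).vars ∨ i ∈ (Φ.poly y).vars := by
  classical
  have hC : ∀ (c : F) (p : MvPolynomial σ F), (C c * p).vars ⊆ p.vars := fun c p =>
    (vars_mul _ _).trans (by simp)
  rw [Φ.poly_eq z] at hi
  cases hz : Φ.label z with
  | var i => simp [hz, GateLabel.sources] at h
  | const c => simp [hz, GateLabel.sources] at h
  | add a x' b y' =>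
    obtain ⟨rfl, rfl⟩ : x' = x ∧ y' = y := by simpa [hz, GateLabel.sources] using h
    rw [hz] at hi
    exact (Finset.mem_union.1 (vars_add_subset _ _ hi)).imp (fun h => hC _ _ h) (fun h => hC _ _ h)
  | mul a x' b y' =>
    obtain ⟨rfl, rfl⟩ : x' = x ∧ y' = y := by simpa [hz, GateLabel.sources] using h
    rw [hz] at hi
    exact (Finset.mem_union.1 (vars_mul _ _ hi)).imp (fun h => hC _ _ h) (fun h => hC _ _ h)

theorem label_eq_var_of_mem_vars (Φ : ArithCircuit F σ) {z : Φ.Gate}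
    (h : (Φ.label z).sources = []) {i : σ} (hi : i ∈ (Φ.poly z).vars) :
    Φ.label z = .var i := by
  classical
  rw [Φ.poly_eq z] at hi
  cases hz : Φ.label z with
  | var j =>
    rw [hz] at hi
    have : i ∈ (Finsupp.single j 1 : σ →₀ ℕ).support := by
      rw [MvPolynomial.mem_vars_iff_mem_support] at hi
      obtain ⟨d, hd, hid⟩ := hi
      have := MvPolynomial.support_monomial_subset hd
      rw [Finset.mem_singleton] at this
      rwa [this] at hid
    have := Finsupp.support_single_subset this
    rw [Finset.mem_singleton.1 this]
  | const c => rw [hz] at hi; simp at hi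
  | add a x b y => simp [hz, GateLabel.sources] at h
  | mul a x b y => simp [hz, GateLabel.sources] at h

theorem card_vars_le_one (Φ : ArithCircuit F σ) {z : Φ.Gate}
    (h : (Φ.label z).sources = []) : (Φ.poly z).vars.card ≤ 1 := by
  refine Finset.card_le_one.2 fun i hi j hj => ?_
  have := Φ.label_eq_var_of_mem_vars h hi
  rw [Φ.label_eq_var_of_mem_vars h hj] at this
  exact (GateLabel.var.inj this).symm

/-- A variable occurring in a polynomial computed in a subcircuit labels one of its inputs. -/
theorem IsSubcircuit.exists_label_eq_var {Φ : ArithCircuit F σ} {W : Finset Φ.Gate}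
    (hW : Φ.IsSubcircuit W) {z : Φ.Gate} (hz : z ∈ W) {i : σ} (hi : i ∈ (Φ.poly z).vars) :
    ∃ g ∈ W, Φ.label g = .var i := by
  induction z using Φ.acyclic.induction with
  | _ z ih =>
    rcases Φ.sources_eq_nil_or_pair z with h | ⟨x, y, h⟩
    · exact ⟨z, hz, Φ.label_eq_var_of_mem_vars h hi⟩
    · have hx : Φ.Wire x z := by simp [Wire, h]
      have hy : Φ.Wire y z := by simp [Wire, h]
      rcases Φ.mem_vars_or_mem_vars h hi with hi | hi
      · exact ih x hx (hW z hz x hx) hi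
      · exact ih y hy (hW z hz y hy) hi

theorem IsSubcircuit.card_vars_le {Φ : ArithCircuit F σ} {W : Finset Φ.Gate}
    (hW : Φ.IsSubcircuit W) {z : Φ.Gate} (hz : z ∈ W) : (Φ.poly z).vars.card ≤ W.card := by
  have : Nonempty Φ.Gate := ⟨z⟩
  choose! g hgW hg using fun i (hi : i ∈ (Φ.poly z).vars) => hW.exists_label_eq_var hz hi
  refine Finset.card_le_card_of_injOn g hgW fun i hi j hj hij => ?_
  have := hg i hi
  rw [hij, hg j hj] at this
  exact (GateLabel.var.inj this).symm

theorem card_vars_le_size (Φ : ArithCircuit F σ) (z : Φ.Gate) :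
    (Φ.poly z).vars.card ≤ Φ.size := by
  let := Φ.fintypeGate
  exact IsSubcircuit.card_vars_le (W := Finset.univ) (fun _ _ _ _ => Finset.mem_univ _)
    (Finset.mem_univ z)

/-! ### Merge costs in a forest -/

/-- The number of variables on the side of a gate that sees fewer variables; zero at inputs. -/
noncomputable def mergeCost (Φ : ArithCircuit F σ) (z : Φ.Gate) : ℕ :=
  match (Φ.label z).sources with
  | [x, y] => min (Φ.poly x).vars.card (Φ.poly y).vars.card
  | _ => 0

theorem mergeCost_of_nil (Φ : ArithCircuit F σ) {z : Φ.Gate}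
    (h : (Φ.label z).sources = []) : Φ.mergeCost z = 0 := by
  simp [mergeCost, h]

theorem mergeCost_of_pair (Φ : ArithCircuit F σ) {z x y : Φ.Gate}
    (h : (Φ.label z).sources = [x, y]) :
    Φ.mergeCost z = min (Φ.poly x).vars.card (Φ.poly y).vars.card := by
  simp [mergeCost, h]

/-- Merging two groups of sizes `a` and `b` at a cost of `min a b` is paid for by the growth of the
potential `t ↦ t log t`. -/
theorem small_to_large_potential (a b : ℕ) :
    (a : ℝ) * Real.log a + b * Real.log b + (min a b : ℕ) * Real.log 2 ≤
      ((a + b + 1 : ℕ) : ℝ) * Real.log ((a + b + 1 : ℕ) : ℝ) := by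
  wlog hab : a ≤ b generalizing a b
  · have := this b a (by omega)
    rw [min_comm, add_comm b a] at this
    linarith
  have hmono : ∀ c : ℕ, c ≤ a + b + 1 →
      (c : ℝ) * Real.log c ≤ c * Real.log ((a + b + 1 : ℕ) : ℝ) := by
    intro c hc
    rcases Nat.eq_zero_or_pos c with rfl | h0
    · simp
    · have : Real.log c ≤ Real.log ((a + b + 1 : ℕ) : ℝ) :=
        Real.log_le_log (by exact_mod_cast h0) (by exact_mod_cast hc)
      gcongr
  have h1 := hmono b (by omega)
  have h2 : (a : ℝ) * (Real.log a + Real.log 2) ≤ a * Real.log ((a + b + 1 : ℕ) : ℝ) := by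
    rcases Nat.eq_zero_or_pos a with rfl | h0
    · simp
    · have ha : (0 : ℝ) < a := by exact_mod_cast h0
      rw [← Real.log_mul ha.ne' two_ne_zero]
      have : Real.log (a * 2) ≤ Real.log ((a + b + 1 : ℕ) : ℝ) :=
        Real.log_le_log (by positivity) (by exact_mod_cast (by omega : a * 2 ≤ a + b + 1))
      gcongr
  have h3 : 0 ≤ Real.log ((a + b + 1 : ℕ) : ℝ) := Real.log_natCast_nonneg _
  rw [min_eq_left hab]
  push_cast at *
  nlinarith

/-- The small-to-large estimate: in a forest with `s` gates the total merge cost is at most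
`s log₂ s`. -/
theorem IsSubcircuit.sum_mergeCost_le {Φ : ArithCircuit F σ} (hpar : Φ.NoParallelWires)
    (hac : Φ.graph.IsAcyclic) {W : Finset Φ.Gate} (hW : Φ.IsSubcircuit W) :
    ((∑ w ∈ W, Φ.mergeCost w : ℕ) : ℝ) * Real.log 2 ≤ W.card * Real.log W.card := by
  classical
  induction hn : W.card using Nat.strong_induction_on generalizing W with
  | _ n ih =>
    subst hn
    rcases W.eq_empty_or_nonempty with rfl | hne
    · simp
    obtain ⟨w, hw, hwmax⟩ := Finset.exists_max_image W Φ.rank hne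
    have hmax : ∀ z ∈ W, ¬ Φ.Wire w z := fun z hz hwz =>
      (Φ.rank_lt_of_wire hwz).not_ge (hwmax z hz)
    rcases Φ.sources_eq_nil_or_pair w with h | ⟨x, y, h⟩
    · have hsub : Φ.IsSubcircuit (W.erase w) := by
        intro z hz a ha
        rw [Finset.mem_erase] at hz ⊢
        exact ⟨fun e => hmax z hz.2 (e ▸ ha), hW z hz.2 a ha⟩
      have h1 := ih _ (Finset.card_erase_lt_of_mem hw) hsub rfl
      rw [← Finset.add_sum_erase W _ hw, Φ.mergeCost_of_nil h, zero_add]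
      have h2 := small_to_large_potential (W.erase w).card 0
      rw [add_zero, Finset.card_erase_add_one hw] at h2
      simp only [Nat.cast_zero, zero_mul, min_zero, add_zero] at h2
      exact h1.trans h2
    · obtain ⟨A, B, hA, hB, hxA, hyB, hAB, hwA, hwB, hmem⟩ := hW.exists_split hpar hac hw hmax h
      have hWeq : W = insert w (A ∪ B) := by ext z; simp [hmem]
      have hwAB : w ∉ A ∪ B := by simp [hwA, hwB]
      have hcard : W.card = A.card + B.card + 1 := by
        rw [hWeq, Finset.card_insert_of_notMem hwAB, Finset.card_union_of_disjoint hAB]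
      have hsum : ∑ z ∈ W, Φ.mergeCost z =
          Φ.mergeCost w + (∑ z ∈ A, Φ.mergeCost z + ∑ z ∈ B, Φ.mergeCost z) := by
        rw [hWeq, Finset.sum_insert hwAB, Finset.sum_union hAB]
      have hcost : Φ.mergeCost w ≤ min A.card B.card := by
        rw [Φ.mergeCost_of_pair h]
        exact min_le_min (hA.card_vars_le hxA) (hB.card_vars_le hyB)
      have h1 := ih A.card (by omega) hA rfl
      have h2 := ih B.card (by omega) hB rfl
      have h3 := small_to_large_potential A.card B.card
      have h4 : (Φ.mergeCost w : ℝ) * Real.log 2 ≤ (min A.card B.card : ℕ) * Real.log 2 := by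
        have := Real.log_nonneg (one_le_two (α := ℝ))
        gcongr
      rw [hsum, hcard]
      push_cast at *
      linarith

/-! ### Nearly parallel gradients -/

/-- Away from at most `D` variables, the gradients of the polynomials at `z` and `v` are
parallel. -/
def GradientParallel (Φ : ArithCircuit F σ) (D : ℕ) (z v : Φ.Gate) : Prop :=
  ∃ S : Finset σ, S.card ≤ D ∧ ∃ Q, ∀ k ∉ S, pderiv k (Φ.poly z) = Q * pderiv k (Φ.poly v)

/-- One of the two children loses only `mergeCost` many variables, and its gradient agrees with that
of the gate, up to a factor, on all the others. -/
theorem exists_heavy_child (Φ : ArithCircuit F σ) {z x y : Φ.Gate}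
    (h : (Φ.label z).sources = [x, y]) :
    ∃ u, Φ.Wire u z ∧ (Φ.poly z).vars.card ≤ (Φ.poly u).vars.card + Φ.mergeCost z ∧
      Φ.GradientParallel (Φ.mergeCost z) z u := by
  classical
  have hx : Φ.Wire x z := by simp [Wire, h]
  have hy : Φ.Wire y z := by simp [Wire, h]
  have hcard : (Φ.poly z).vars.card ≤ (Φ.poly x).vars.card + (Φ.poly y).vars.card :=
    (Finset.card_le_card fun i hi => Finset.mem_union.2 (Φ.mem_vars_or_mem_vars h hi)).trans
      (Finset.card_union_le _ _)
  rw [Φ.mergeCost_of_pair h]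
  rcases le_total (Φ.poly y).vars.card (Φ.poly x).vars.card with hle | hle
  · rw [min_eq_right hle]
    exact ⟨x, hx, hcard, _, le_rfl, Φ.exists_pderiv_poly_eq_left h⟩
  · rw [min_eq_left hle]
    exact ⟨y, hy, by omega, _, le_rfl, Φ.exists_pderiv_poly_eq_right h⟩

/-- Descending from a gate that sees many variables, always to the child that sees more of them,
one meets gates of total merge cost exceeding `D` before more than `D` variables are lost. -/
theorem exists_descending_path (Φ : ArithCircuit F σ) (z : Φ.Gate) (D : ℕ)
    (hz : D + 1 < (Φ.poly z).vars.card) :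
    ∃ P : Finset Φ.Gate, D < ∑ w ∈ P, Φ.mergeCost w ∧
      ∀ v ∈ P, Φ.rank v ≤ Φ.rank z ∧ Φ.GradientParallel D z v := by
  classical
  induction z using Φ.acyclic.induction generalizing D with
  | _ z ih =>
    have hself : Φ.GradientParallel D z z := ⟨∅, by simp, 1, by simp⟩
    rcases Φ.sources_eq_nil_or_pair z with h | ⟨x, y, h⟩
    · have := Φ.card_vars_le_one h
      omega
    obtain ⟨u, hu, hcard, T, hT, R, hR⟩ := Φ.exists_heavy_child h
    rcases lt_or_ge D (Φ.mergeCost z) with hD | hD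
    · refine ⟨{z}, by simpa using hD, fun v hv => ?_⟩
      rw [Finset.mem_singleton] at hv
      subst hv
      exact ⟨le_rfl, hself⟩
    · obtain ⟨P, hP, hPz⟩ := ih u hu (D - Φ.mergeCost z) (by omega)
      have hlt := Φ.rank_lt_of_wire hu
      have hzP : z ∉ P := fun hz => (hPz z hz).1.not_gt hlt
      refine ⟨insert z P, by rw [Finset.sum_insert hzP]; omega, fun v hv => ?_⟩
      rcases Finset.mem_insert.1 hv with rfl | hv
      · exact ⟨le_rfl, hself⟩
      obtain ⟨hrank, S, hS, Q, hQ⟩ := hPz v hv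
      refine ⟨hrank.trans hlt.le, S ∪ T, (Finset.card_union_le _ _).trans (by omega), R * Q,
        fun k hk => ?_⟩
      rw [Finset.mem_union, not_or] at hk
      rw [hR k hk.2, hQ k hk.1, mul_assoc]

/-- A lower bound for multi-output formulas: if each `f i` has more than `D + 1` variables, and no
two members of the family have gradients that become parallel to a common vector after at most `D`
coordinates of each are dropped, then computing all `f i` together takes `s` gates with
`s log₂ s ≥ |ι| (D + 1)`. -/
theorem IsMultiFormulaFor.card_mul_le {Φ : ArithCircuit F σ} {ι : Type*} [Fintype ι]
    {f : ι → MvPolynomial σ F} (hΦ : Φ.IsMultiFormulaFor f) (D : ℕ)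
    (hvars : ∀ i, D + 1 < (f i).vars.card)
    (hrob : ∀ i j, i ≠ j → ¬ ∃ (p Q R : MvPolynomial σ F) (S T : Finset σ),
      S.card ≤ D ∧ T.card ≤ D ∧
      (∀ k ∉ S, pderiv k (f i) = Q * pderiv k p) ∧ ∀ k ∉ T, pderiv k (f j) = R * pderiv k p) :
    ((Fintype.card ι * (D + 1) : ℕ) : ℝ) * Real.log 2 ≤ Φ.size * Real.log Φ.size := by
  classical
  let := Φ.fintypeGate
  obtain ⟨hpar, hac, hcomp⟩ := hΦ
  choose z hz using hcomp
  choose P hP hPz using fun i => Φ.exists_descending_path (z i) D (by rw [hz]; exact hvars i)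
  -- A gate on two of the paths would have a gradient nearly parallel to those of both outputs.
  have hdisj : ((Finset.univ : Finset ι) : Set ι).PairwiseDisjoint P := by
    intro i _ j _ hij
    refine Finset.disjoint_left.2 fun v hvi hvj => hrob i j hij ?_
    obtain ⟨-, S, hS, Q, hQ⟩ := hPz i v hvi
    obtain ⟨-, T, hT, R, hR⟩ := hPz j v hvj
    rw [hz] at hQ hR
    exact ⟨Φ.poly v, Q, R, S, T, hS, hT, hQ, hR⟩
  have hle : Fintype.card ι * (D + 1) ≤ ∑ w, Φ.mergeCost w :=
    calc Fintype.card ι * (D + 1) = ∑ _i : ι, (D + 1) := by simp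
      _ ≤ ∑ i, ∑ w ∈ P i, Φ.mergeCost w := Finset.sum_le_sum fun i _ => hP i
      _ = ∑ w ∈ Finset.univ.biUnion P, Φ.mergeCost w := (Finset.sum_biUnion hdisj).symm
      _ ≤ ∑ w, Φ.mergeCost w := Finset.sum_le_sum_of_subset (Finset.subset_univ _)
  have hlog : 0 ≤ Real.log 2 := Real.log_nonneg one_le_two
  calc ((Fintype.card ι * (D + 1) : ℕ) : ℝ) * Real.log 2
      ≤ ((∑ w, Φ.mergeCost w : ℕ) : ℝ) * Real.log 2 := by gcongr
    _ ≤ _ := IsSubcircuit.sum_mergeCost_le hpar hac (W := Finset.univ)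
        (fun _ _ _ _ => Finset.mem_univ _)

end LowerBound

end ArithCircuit

/-! ### Building formulas -/

/-- Renaming the gates from which the wires of a gate come. -/
def GateLabel.map {F : Type u} {σ : Type v} {V W : Type} (e : V → W) :
    GateLabel F σ V → GateLabel F σ W
  | .var i => .var i
  | .const c => .const c
  | .add a x b y => .add a (e x) b (e y)
  | .mul a x b y => .mul a (e x) b (e y)

theorem GateLabel.sources_map {F : Type u} {σ : Type v} {V W : Type} (e : V → W)
    (l : GateLabel F σ V) : (l.map e).sources = l.sources.map e := by
  cases l <;> rfl

namespace ArithCircuit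

section Constructions

variable {F : Type u} {σ : Type v}

/-- Every gate feeds at most one other gate. -/
def FanOutLEOne (Φ : ArithCircuit F σ) : Prop :=
  ∀ x z z', Φ.Wire x z → Φ.Wire x z' → z = z'

/-- With fan-out at most one there is no undirected cycle: the two cycle neighbours of a gate of
least rank on a cycle would both be fed by that gate. -/
theorem FanOutLEOne.isAcyclic {Φ : ArithCircuit F σ} (h : Φ.FanOutLEOne) :
    Φ.graph.IsAcyclic := by
  classical
  intro a c hc
  obtain ⟨m, hm, hmin⟩ := Finset.exists_min_image c.support.toFinset Φ.rank
    ⟨a, by simp⟩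
  rw [List.mem_toFinset] at hm
  obtain ⟨c', hc', hsupp⟩ : ∃ c' : Φ.graph.Walk m m, c'.IsCycle ∧
      ∀ b ∈ c'.support, b ∈ c.support :=
    ⟨c.rotate m hm, hc.rotate hm, fun b hb => (c.mem_support_rotate_iff m hm).1 hb⟩
  have hnil : ¬ c'.Nil := hc'.not_nil
  have hwire : ∀ b ∈ c'.support, Φ.graph.Adj m b → Φ.Wire m b := by
    intro b hb hadj
    rcases ((SimpleGraph.fromRel_adj _ _ _).1 hadj).2 with hw | hw
    · exact hw
    · exact absurd (hmin b (List.mem_toFinset.2 (hsupp b hb))) (Φ.rank_lt_of_wire hw).not_ge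
  exact hc'.snd_ne_penultimate (h m _ _
    (hwire _ (c'.getVert_mem_support _) (c'.adj_snd hnil))
    (hwire _ (c'.getVert_mem_support _) (c'.adj_penultimate hnil).symm))

theorem isTree_of_unique_output {Φ : ArithCircuit F σ} (h : Φ.FanOutLEOne) {r : Φ.Gate}
    (hr : ∀ z, Φ.IsOutput z ↔ z = r) : Φ.graph.IsTree := by
  have := Φ.fintypeGate
  have hreach : ∀ x, Φ.graph.Reachable x r := by
    have hwf : WellFounded fun a b : Φ.Gate => Φ.rank b < Φ.rank a :=
      haveI : IsTrans Φ.Gate (fun a b => Φ.rank b < Φ.rank a) := ⟨fun _ _ _ h h' => h'.trans h⟩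
      haveI : Std.Irrefl (fun a b : Φ.Gate => Φ.rank b < Φ.rank a) := ⟨fun _ => lt_irrefl _⟩
      Finite.wellFounded_of_trans_of_irrefl _
    intro x
    induction x using hwf.induction with
    | _ x ih =>
      by_cases hx : x = r
      · rw [hx]
      · have := mt (hr x).1 hx
        simp only [IsOutput, not_forall, not_not] at this
        obtain ⟨w, hw⟩ := this
        exact hw.graph_adj.reachable.trans (ih w (Φ.rank_lt_of_wire hw))
  exact ⟨(SimpleGraph.connected_iff_exists_forall_reachable _).2 ⟨r, fun x => (hreach x).symm⟩,
    h.isAcyclic⟩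

theorem poly_eq_of_label_eq_map [CommSemiring F] {Φ Ψ : ArithCircuit F σ} (e : Φ.Gate → Ψ.Gate)
    (he : ∀ x, Ψ.label (e x) = (Φ.label x).map e) (x : Φ.Gate) : Ψ.poly (e x) = Φ.poly x := by
  induction x using Φ.acyclic.induction with
  | _ x ih =>
    rw [Ψ.poly_eq, Φ.poly_eq, he]
    cases hx : Φ.label x with
    | var i => rfl
    | const c => rfl
    | add a y b z =>
      simp only [GateLabel.map]
      rw [ih y (by simp [hx, GateLabel.sources]), ih z (by simp [hx, GateLabel.sources])]
    | mul a y b z =>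
      simp only [GateLabel.map]
      rw [ih y (by simp [hx, GateLabel.sources]), ih z (by simp [hx, GateLabel.sources])]

/-- The circuit with a single gate, an input. -/
def single (l : GateLabel F σ Unit) (hl : l.sources = []) : ArithCircuit F σ where
  Gate := Unit
  fintypeGate := inferInstance
  label _ := l
  acyclic := ⟨fun _ => ⟨_, fun _ h => by simp [hl] at h⟩⟩

/-- Two circuits side by side, with one more gate on top, labelled by `l`. -/
def join (Φ Ψ : ArithCircuit F σ) (l : GateLabel F σ (Φ.Gate ⊕ Ψ.Gate)) : ArithCircuit F σ where
  Gate := Option (Φ.Gate ⊕ Ψ.Gate)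
  fintypeGate :=
    have := Φ.fintypeGate
    have := Ψ.fintypeGate
    inferInstance
  label
    | none => l.map some
    | some (.inl x) => (Φ.label x).map fun y => some (.inl y)
    | some (.inr x) => (Ψ.label x).map fun y => some (.inr y)
  acyclic := by
    have h1 : ∀ z : Φ.Gate ⊕ Ψ.Gate, Acc (fun x z : Option (Φ.Gate ⊕ Ψ.Gate) =>
      x ∈ GateLabel.sources
        (match z with
          | none => l.map some
          | some (.inl x) => (Φ.label x).map fun y => some (.inl y)
          | some (.inr x) => (Ψ.label x).map fun y => some (.inr y))) (some z) := by
      rintro (z | z)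
      · induction z using Φ.acyclic.induction with
        | _ z ih =>
          refine ⟨_, fun y hy => ?_⟩
          simp only [GateLabel.sources_map, List.mem_map] at hy
          obtain ⟨y, hy, rfl⟩ := hy
          exact ih y hy
      · induction z using Ψ.acyclic.induction with
        | _ z ih =>
          refine ⟨_, fun y hy => ?_⟩
          simp only [GateLabel.sources_map, List.mem_map] at hy
          obtain ⟨y, hy, rfl⟩ := hy
          exact ih y hy
    refine ⟨fun z => ?_⟩
    rcases z with _ | z
    · refine ⟨_, fun y hy => ?_⟩
      simp only [GateLabel.sources_map, List.mem_map] at hy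
      obtain ⟨y, hy, rfl⟩ := hy
      exact h1 y
    · exact h1 z

/-- The disjoint union of a finite family of circuits. -/
def disjointUnion {n : ℕ} (Φ : Fin n → ArithCircuit F σ) : ArithCircuit F σ where
  Gate := Σ i, (Φ i).Gate
  fintypeGate :=
    have := fun i => (Φ i).fintypeGate
    inferInstance
  label z := ((Φ z.1).label z.2).map fun y => ⟨z.1, y⟩
  acyclic := by
    refine ⟨fun ⟨i, z⟩ => ?_⟩
    induction z using (Φ i).acyclic.induction with
    | _ z ih =>
      refine ⟨_, fun y hy => ?_⟩
      simp only [GateLabel.sources_map, List.mem_map] at hy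
      obtain ⟨y, hy, rfl⟩ := hy
      exact ih y hy

/-- What `join Φ Ψ l` looks like, without reference to how its gates are encoded. -/
theorem exists_join (Φ Ψ : ArithCircuit F σ) (l : GateLabel F σ (Φ.Gate ⊕ Ψ.Gate)) :
    ∃ (Θ : ArithCircuit F σ) (a : Φ.Gate → Θ.Gate) (b : Ψ.Gate → Θ.Gate) (t : Θ.Gate),
      Function.Injective a ∧ Function.Injective b ∧ (∀ x y, a x ≠ b y) ∧
      (∀ x, t ≠ a x) ∧ (∀ y, t ≠ b y) ∧
      (∀ z, z = t ∨ (∃ x, z = a x) ∨ ∃ y, z = b y) ∧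
      (∀ x, Θ.label (a x) = (Φ.label x).map a) ∧ (∀ y, Θ.label (b y) = (Ψ.label y).map b) ∧
      Θ.label t = l.map (Sum.elim a b) ∧ Θ.size = Φ.size + Ψ.size + 1 := by
  refine ⟨join Φ Ψ l, fun x => some (.inl x), fun y => some (.inr y), none,
    (Option.some_injective _).comp Sum.inl_injective,
    (Option.some_injective _).comp Sum.inr_injective,
    fun x y h => Sum.inl_ne_inr (Option.some_injective _ h), fun x => (Option.some_ne_none _).symm,
    fun y => (Option.some_ne_none _).symm, ?_, fun _ => rfl, fun _ => rfl, ?_, ?_⟩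
  · rintro (_ | x | y)
    · exact Or.inl rfl
    · exact Or.inr (Or.inl ⟨x, rfl⟩)
    · exact Or.inr (Or.inr ⟨y, rfl⟩)
  · have : (Sum.elim (fun x => some (.inl x)) fun y => some (.inr y) :
        Φ.Gate ⊕ Ψ.Gate → Option (Φ.Gate ⊕ Ψ.Gate)) = some := by
      ext1 (x | y) <;> rfl
    exact congrArg (GateLabel.map · l) this.symm
  · let := Φ.fintypeGate
    let := Ψ.fintypeGate
    exact (Fintype.card_option (α := Φ.Gate ⊕ Ψ.Gate)).trans (by rw [Fintype.card_sum]; rfl)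

theorem wire_map_iff {Φ Ψ : ArithCircuit F σ} {e : Φ.Gate → Ψ.Gate} {x : Φ.Gate}
    (he : Ψ.label (e x) = (Φ.label x).map e) (w : Ψ.Gate) :
    Ψ.Wire w (e x) ↔ ∃ y, Φ.Wire y x ∧ e y = w := by
  simp only [Wire, he, GateLabel.sources_map, List.mem_map]

/-- What `disjointUnion Φ` looks like, without reference to how its gates are encoded. -/
theorem exists_disjointUnion {n : ℕ} (Φ : Fin n → ArithCircuit F σ) :
    ∃ (Θ : ArithCircuit F σ) (e : ∀ i, (Φ i).Gate → Θ.Gate),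
      (∀ i j x y, e i x = e j y → (⟨i, x⟩ : Σ i, (Φ i).Gate) = ⟨j, y⟩) ∧
      (∀ z, ∃ i x, z = e i x) ∧ ∀ i x, Θ.label (e i x) = ((Φ i).label x).map (e i) :=
  ⟨disjointUnion Φ, fun i x => ⟨i, x⟩, fun _ _ _ _ h => h, fun z => ⟨z.1, z.2, rfl⟩,
    fun _ _ => rfl⟩

variable [CommSemiring F]

/-- `f` is computed at the only output of a circuit with `s` gates in which every gate feeds at most
one other gate. Such a circuit is a formula. -/
def HasFormula (f : MvPolynomial σ F) (s : ℕ) : Prop :=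
  ∃ Φ : ArithCircuit F σ, Φ.NoParallelWires ∧ Φ.FanOutLEOne ∧
    ∃ r, (∀ z, Φ.IsOutput z ↔ z = r) ∧ Φ.poly r = f ∧ Φ.size = s

theorem HasFormula.exists_isFormulaFor {f : MvPolynomial σ F} {s : ℕ} (h : HasFormula f s) :
    ∃ Φ : ArithCircuit F σ, Φ.IsFormulaFor f ∧ Φ.size = s := by
  obtain ⟨Φ, hpar, hfan, r, hr, hf, hs⟩ := h
  exact ⟨Φ, ⟨hpar, isTree_of_unique_output hfan hr, r, hr, hf⟩, hs⟩

theorem hasFormula_X (i : σ) : HasFormula (X i : MvPolynomial σ F) 1 :=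
  ⟨single (.var i) rfl, fun _ => List.nodup_nil, fun _ _ _ h => absurd h List.not_mem_nil, (),
    fun _ => ⟨fun _ => rfl, fun _ _ h => absurd h List.not_mem_nil⟩, (poly_eq _ _).trans rfl, rfl⟩

theorem hasFormula_C (c : F) : HasFormula (C c : MvPolynomial σ F) 1 :=
  ⟨single (.const c) rfl, fun _ => List.nodup_nil, fun _ _ _ h => absurd h List.not_mem_nil, (),
    fun _ => ⟨fun _ => rfl, fun _ _ h => absurd h List.not_mem_nil⟩, (poly_eq _ _).trans rfl, rfl⟩

/-- A new top gate, fed by the outputs of two formulas side by side, gives a formula. -/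
theorem exists_join_formula {Φ Ψ : ArithCircuit F σ} {r : Φ.Gate} {q : Ψ.Gate}
    {l : GateLabel F σ (Φ.Gate ⊕ Ψ.Gate)} (hl : l.sources = [.inl r, .inr q])
    (hΦ : Φ.NoParallelWires) (hΨ : Ψ.NoParallelWires) (hΦ' : Φ.FanOutLEOne) (hΨ' : Ψ.FanOutLEOne)
    (hr : ∀ z, Φ.IsOutput z ↔ z = r) (hq : ∀ z, Ψ.IsOutput z ↔ z = q) :
    ∃ (Θ : ArithCircuit F σ) (a : Φ.Gate → Θ.Gate) (b : Ψ.Gate → Θ.Gate) (t : Θ.Gate),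
      Θ.NoParallelWires ∧ Θ.FanOutLEOne ∧ (∀ z, Θ.IsOutput z ↔ z = t) ∧
      Θ.poly (a r) = Φ.poly r ∧ Θ.poly (b q) = Ψ.poly q ∧
      Θ.label t = l.map (Sum.elim a b) ∧ Θ.size = Φ.size + Ψ.size + 1 := by
  obtain ⟨Θ, a, b, t, ha, hb, hab, hta, htb, hall, hla, hlb, hlt, hsize⟩ := exists_join Φ Ψ l
  have hwa := fun x => wire_map_iff (hla x)
  have hwb := fun y => wire_map_iff (hlb y)
  have hwt : ∀ w, Θ.Wire w t ↔ w = a r ∨ w = b q := by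
    intro w
    simp [Wire, hlt, GateLabel.sources_map, hl]
  have hrout := (hr r).2 rfl
  have hqout := (hq q).2 rfl
  refine ⟨Θ, a, b, t, ?_, ?_, ?_, poly_eq_of_label_eq_map a hla r,
    poly_eq_of_label_eq_map b hlb q, hlt, hsize⟩
  · intro z
    rcases hall z with rfl | ⟨x, rfl⟩ | ⟨y, rfl⟩
    · simp [hlt, GateLabel.sources_map, hl, hab]
    · rw [hla, GateLabel.sources_map]
      exact (hΦ x).map ha
    · rw [hlb, GateLabel.sources_map]
      exact (hΨ y).map hb
  · intro w z z' h h'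
    rcases hall z with rfl | ⟨x, rfl⟩ | ⟨x, rfl⟩ <;>
      rcases hall z' with rfl | ⟨x', rfl⟩ | ⟨x', rfl⟩
    · rfl
    · obtain ⟨y, hy, rfl⟩ := (hwa _ _).1 h'
      rcases (hwt _).1 h with h | h
      · exact absurd (ha h ▸ hy) (hrout _)
      · exact absurd h (hab _ _)
    · obtain ⟨y, hy, rfl⟩ := (hwb _ _).1 h'
      rcases (hwt _).1 h with h | h
      · exact absurd h.symm (hab _ _)
      · exact absurd (hb h ▸ hy) (hqout _)
    · obtain ⟨y, hy, rfl⟩ := (hwa _ _).1 h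
      rcases (hwt _).1 h' with h' | h'
      · exact absurd (ha h' ▸ hy) (hrout _)
      · exact absurd h' (hab _ _)
    · obtain ⟨y, hy, rfl⟩ := (hwa _ _).1 h
      obtain ⟨y', hy', hyy⟩ := (hwa _ _).1 h'
      rw [hΦ' _ _ _ hy (ha hyy ▸ hy')]
    · obtain ⟨y, hy, rfl⟩ := (hwa _ _).1 h
      obtain ⟨y', hy', hyy⟩ := (hwb _ _).1 h'
      exact absurd hyy.symm (hab _ _)
    · obtain ⟨y, hy, rfl⟩ := (hwb _ _).1 h
      rcases (hwt _).1 h' with h' | h'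
      · exact absurd h'.symm (hab _ _)
      · exact absurd (hb h' ▸ hy) (hqout _)
    · obtain ⟨y, hy, rfl⟩ := (hwb _ _).1 h
      obtain ⟨y', hy', hyy⟩ := (hwa _ _).1 h'
      exact absurd hyy (hab _ _)
    · obtain ⟨y, hy, rfl⟩ := (hwb _ _).1 h
      obtain ⟨y', hy', hyy⟩ := (hwb _ _).1 h'
      rw [hΨ' _ _ _ hy (hb hyy ▸ hy')]
  · intro z
    constructor
    · intro hz
      rcases hall z with rfl | ⟨x, rfl⟩ | ⟨y, rfl⟩
      · rfl
      · have hx : x = r := (hr x).1 fun w hw => hz (a w) ((hwa _ _).2 ⟨x, hw, rfl⟩)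
        exact absurd ((hwt _).2 (Or.inl (congrArg a hx))) (hz t)
      · have hy : y = q := (hq y).1 fun w hw => hz (b w) ((hwb _ _).2 ⟨y, hw, rfl⟩)
        exact absurd ((hwt _).2 (Or.inr (congrArg b hy))) (hz t)
    · rintro rfl w hw
      rcases hall w with rfl | ⟨x, rfl⟩ | ⟨y, rfl⟩
      · exact hw.ne rfl
      · obtain ⟨x', -, h⟩ := (hwa _ _).1 hw
        exact hta _ h.symm
      · obtain ⟨y', -, h⟩ := (hwb _ _).1 hw
        exact htb _ h.symm

theorem HasFormula.add {f g : MvPolynomial σ F} {s t : ℕ} (hf : HasFormula f s)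
    (hg : HasFormula g t) : HasFormula (f + g) (s + t + 1) := by
  obtain ⟨Φ, h1, h2, r, hr, rfl, rfl⟩ := hf
  obtain ⟨Ψ, h3, h4, q, hq, rfl, rfl⟩ := hg
  obtain ⟨Θ, a, b, t, h5, h6, h7, h8, h9, h10, h11⟩ :=
    exists_join_formula (l := .add 1 (.inl r) 1 (.inr q)) rfl h1 h3 h2 h4 hr hq
  refine ⟨Θ, h5, h6, t, h7, ?_, h11⟩
  rw [Θ.poly_eq, h10]
  simp [GateLabel.map, h8, h9]

theorem HasFormula.mul {f g : MvPolynomial σ F} {s t : ℕ} (hf : HasFormula f s)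
    (hg : HasFormula g t) : HasFormula (f * g) (s + t + 1) := by
  obtain ⟨Φ, h1, h2, r, hr, rfl, rfl⟩ := hf
  obtain ⟨Ψ, h3, h4, q, hq, rfl, rfl⟩ := hg
  obtain ⟨Θ, a, b, t, h5, h6, h7, h8, h9, h10, h11⟩ :=
    exists_join_formula (l := .mul 1 (.inl r) 1 (.inr q)) rfl h1 h3 h2 h4 hr hq
  refine ⟨Θ, h5, h6, t, h7, ?_, h11⟩
  rw [Θ.poly_eq, h10]
  simp [GateLabel.map, h8, h9]

theorem HasFormula.sum {n : ℕ} {f : Fin n → MvPolynomial σ F} {s : ℕ}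
    (h : ∀ i, HasFormula (f i) s) : HasFormula (∑ i, f i) (n * (s + 1) + 1) := by
  induction n with
  | zero => simpa using hasFormula_C (0 : F)
  | succ n ih =>
    rw [Fin.sum_univ_succ, add_comm]
    convert (ih fun i => h i.succ).add (h 0) using 1
    ring

theorem exists_hasFormula (f : MvPolynomial σ F) : ∃ s, HasFormula f s := by
  induction f using MvPolynomial.induction_on with
  | C a => exact ⟨_, hasFormula_C a⟩
  | add p q hp hq =>
    obtain ⟨s, hs⟩ := hp
    obtain ⟨t, ht⟩ := hq
    exact ⟨_, hs.add ht⟩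
  | mul_X p i hp =>
    obtain ⟨s, hs⟩ := hp
    exact ⟨_, hs.mul (hasFormula_X i)⟩

/-- Every finite family has a multi-output formula, namely separate formulas side by side. Hence
`multiFormulaSize` is attained, and not the infimum of the empty set. -/
theorem exists_isMultiFormulaFor {n : ℕ} (f : Fin n → MvPolynomial σ F) :
    ∃ Φ : ArithCircuit F σ, Φ.IsMultiFormulaFor f := by
  choose s Φ hpar hfan r _ hf _ using fun i => exists_hasFormula (f i)
  obtain ⟨Θ, e, hinj, hall, hlabel⟩ := exists_disjointUnion Φ
  refine ⟨Θ, ?_, FanOutLEOne.isAcyclic ?_, fun i => ⟨e i (r i), ?_⟩⟩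
  · intro z
    obtain ⟨i, x, rfl⟩ := hall z
    rw [hlabel, GateLabel.sources_map]
    exact (hpar i x).map fun y y' h => by simpa using hinj i i y y' h
  · intro w z z' h h'
    obtain ⟨i, x, rfl⟩ := hall z
    obtain ⟨j, x', rfl⟩ := hall z'
    obtain ⟨y, hy, rfl⟩ := (wire_map_iff (hlabel i x) _).1 h
    obtain ⟨y', hy', hyy⟩ := (wire_map_iff (hlabel j x') _).1 h'
    obtain ⟨rfl, hyy⟩ := Sigma.mk.inj (hinj _ _ _ _ hyy)
    obtain rfl := eq_of_heq hyy
    rw [hfan _ _ _ _ hy hy']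
  · rw [← hf i]
    exact poly_eq_of_label_eq_map (e i) (hlabel i) (r i)

end Constructions

end ArithCircuit

/-! ### Formula size and multi-output formula size -/

section Size

open ArithCircuit

variable {F : Type u} {σ : Type v} [CommSemiring F]

theorem exists_isFormulaFor_size_eq (f : MvPolynomial σ F) :
    ∃ Φ : ArithCircuit F σ, Φ.IsFormulaFor f ∧ Φ.size = formulaSize f := by
  obtain ⟨s, hs⟩ := exists_hasFormula f
  exact Nat.sInf_mem (s := {s : ℕ | ∃ Φ : ArithCircuit F σ, Φ.IsFormulaFor f ∧ Φ.size = s})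
    ⟨s, hs.exists_isFormulaFor⟩

theorem exists_isMultiFormulaFor_size_eq {n : ℕ} (f : Fin n → MvPolynomial σ F) :
    ∃ Φ : ArithCircuit F σ, Φ.IsMultiFormulaFor f ∧ Φ.size = multiFormulaSize f := by
  obtain ⟨Φ, hΦ⟩ := exists_isMultiFormulaFor f
  exact Nat.sInf_mem (s := {s : ℕ | ∃ Φ : ArithCircuit F σ, Φ.IsMultiFormulaFor f ∧ Φ.size = s})
    ⟨_, Φ, hΦ, rfl⟩

theorem ArithCircuit.HasFormula.formulaSize_le {f : MvPolynomial σ F} {s : ℕ} (h : HasFormula f s) :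
    formulaSize f ≤ s :=
  Nat.sInf_le h.exists_isFormulaFor

theorem card_vars_le_formulaSize (f : MvPolynomial σ F) : f.vars.card ≤ formulaSize f := by
  obtain ⟨Φ, ⟨-, -, r, -, rfl⟩, hs⟩ := exists_isFormulaFor_size_eq f
  rw [← hs]
  exact Φ.card_vars_le_size r

end Size

/-! ### A polynomial whose derivatives are hard to compute together -/

section HardFamily

open ArithCircuit

variable (F : Type u) [Field F]

/-- The polynomial `(∑ xᵢ) (∑ (xᵢ² + xᵢ³))`. -/
noncomputable def sumProduct (n : ℕ) : MvPolynomial (Fin n) F :=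
  (∑ i, X i) * ∑ i, X i * X i * (C 1 + X i)

variable {F} {n : ℕ}

theorem formulaSize_sumProduct_le (n : ℕ) : formulaSize (sumProduct F n) ≤ 10 * n + 3 := by
  have h1 : HasFormula (∑ i : Fin n, X i : MvPolynomial (Fin n) F) _ :=
    HasFormula.sum fun i => hasFormula_X i
  have h2 : HasFormula (∑ i : Fin n, X i * X i * (C 1 + X i) : MvPolynomial (Fin n) F) _ :=
    HasFormula.sum fun i =>
      ((hasFormula_X i).mul (hasFormula_X i)).mul ((hasFormula_C 1).add (hasFormula_X i))
  exact (h1.mul h2).formulaSize_le.trans (by omega)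

/-- The derivative `2 xᵢ + 3 xᵢ²` of the summand `xᵢ² + xᵢ³`. -/
noncomputable def summandDeriv (F : Type u) [Field F] {n : ℕ} (i : Fin n) :
    MvPolynomial (Fin n) F :=
  2 * X i + 3 * X i ^ 2

theorem pderiv_summandDeriv {i k : Fin n} (h : k ≠ i) : pderiv k (summandDeriv F i) = 0 := by
  have h2 : pderiv k (2 : MvPolynomial (Fin n) F) = 0 := (pderiv k).map_natCast 2
  have h3 : pderiv k (3 : MvPolynomial (Fin n) F) = 0 := (pderiv k).map_natCast 3
  simp [summandDeriv, pderiv_X_of_ne h.symm, h2, h3]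

theorem pderiv_sum_X (i : Fin n) : pderiv i (∑ j, X j : MvPolynomial (Fin n) F) = 1 := by
  rw [map_sum, Finset.sum_eq_single i (fun j _ hj => pderiv_X_of_ne hj) (by simp), pderiv_X_self]

theorem pderiv_sum_summand (i : Fin n) :
    pderiv i (∑ j, X j * X j * (C 1 + X j) : MvPolynomial (Fin n) F) = summandDeriv F i := by
  rw [map_sum, Finset.sum_eq_single i
    (fun j _ hj => by simp [pderiv_X_of_ne hj]) (by simp)]
  simp [summandDeriv]
  ring

theorem pderiv_sumProduct (i : Fin n) :
    pderiv i (sumProduct F n) =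
      (∑ j, X j * X j * (C 1 + X j)) + (∑ j, X j) * summandDeriv F i := by
  rw [sumProduct, pderiv_mul, pderiv_sum_X, pderiv_sum_summand, one_mul]

theorem pderiv_pderiv_sumProduct {i k : Fin n} (h : k ≠ i) :
    pderiv k (pderiv i (sumProduct F n)) = summandDeriv F k + summandDeriv F i := by
  rw [pderiv_sumProduct, map_add, pderiv_mul, pderiv_sum_X, pderiv_sum_summand,
    pderiv_summandDeriv h, one_mul, mul_zero, add_zero]

/-- Setting all variables but `xₖ` to zero. The image `2 x + 3 x²` of `summandDeriv` is nonzero in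
every characteristic, as `2` and `3` do not both vanish. -/
theorem exists_aeval_summandDeriv_ne_zero (k : Fin n) :
    ∃ φ : MvPolynomial (Fin n) F →ₐ[F] Polynomial F, φ (summandDeriv F k) ≠ 0 ∧
      ∀ l ≠ k, φ (summandDeriv F l) = 0 := by
  classical
  refine ⟨aeval (Pi.single k Polynomial.X), ?_, fun l hl => by simp [summandDeriv, hl]⟩
  intro h
  have h' : (2 * Polynomial.X + 3 * Polynomial.X ^ 2 : Polynomial F) = 0 := by
    simpa [summandDeriv] using h
  have e2 : (2 : Polynomial F) = Polynomial.C 2 := rfl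
  have e3 : (3 : Polynomial F) = Polynomial.C 3 := rfl
  rw [e2, e3] at h'
  have h2 : (2 : F) = 0 := by
    simpa [Polynomial.coeff_X, Polynomial.coeff_X_pow] using congrArg (fun p => p.coeff 1) h'
  have h3 : (3 : F) = 0 := by
    simpa [Polynomial.coeff_X, Polynomial.coeff_X_pow] using congrArg (fun p => p.coeff 2) h'
  exact one_ne_zero (α := F) (by linear_combination h3 - h2)

theorem summandDeriv_sub_ne_zero {k l : Fin n} (h : k ≠ l) :
    summandDeriv F k - summandDeriv F l ≠ 0 := by
  obtain ⟨φ, hk, hφ⟩ := exists_aeval_summandDeriv_ne_zero (F := F) k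
  intro h0
  have := congrArg φ h0
  rw [map_sub, hφ l h.symm, sub_zero, map_zero] at this
  exact hk this

theorem summandDeriv_add_ne_zero {k l : Fin n} (h : k ≠ l) :
    summandDeriv F k + summandDeriv F l ≠ 0 := by
  obtain ⟨φ, hk, hφ⟩ := exists_aeval_summandDeriv_ne_zero (F := F) k
  intro h0
  have := congrArg φ h0
  rw [map_add, hφ l h.symm, add_zero, map_zero] at this
  exact hk this

theorem le_card_vars_pderiv_sumProduct (i : Fin n) :
    n - 1 ≤ (pderiv i (sumProduct F n)).vars.card := by
  have hsub : Finset.univ.erase i ⊆ (pderiv i (sumProduct F n)).vars := by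
    intro k hk
    have hki := Finset.ne_of_mem_erase hk
    by_contra hmem
    have := pderiv_eq_zero_of_notMem_vars hmem
    rw [pderiv_pderiv_sumProduct hki] at this
    exact summandDeriv_add_ne_zero hki this
  simpa using Finset.card_le_card hsub

theorem le_formulaSize_sumProduct (hn : 2 ≤ n) : n ≤ formulaSize (sumProduct F n) := by
  have hvars : (sumProduct F n).vars = Finset.univ := by
    refine Finset.eq_univ_iff_forall.2 fun k => ?_
    by_contra hk
    have := le_card_vars_pderiv_sumProduct (F := F) k
    rw [pderiv_eq_zero_of_notMem_vars hk, vars_0, Finset.card_empty] at this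
    omega
  simpa [hvars] using card_vars_le_formulaSize (sumProduct F n)

/-- For `i ≠ j` the gradients of `∂ᵢf` and `∂ⱼf` are far from parallel: among the coordinates that
remain, any two `k ≠ l` give the nonzero minor `(βₖ - βₗ) (βⱼ - βᵢ)`, where `βₖ` is
`summandDeriv F k`. -/
theorem not_gradients_parallel {i j : Fin n} (hij : i ≠ j) {D : ℕ} (hD : 2 * D + 4 ≤ n)
    (p Q R : MvPolynomial (Fin n) F) (S T : Finset (Fin n)) (hS : S.card ≤ D) (hT : T.card ≤ D)
    (hQ : ∀ k ∉ S, pderiv k (pderiv i (sumProduct F n)) = Q * pderiv k p)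
    (hR : ∀ k ∉ T, pderiv k (pderiv j (sumProduct F n)) = R * pderiv k p) : False := by
  have hcard : 1 < (S ∪ T ∪ {i, j})ᶜ.card := by
    have h1 := Finset.card_union_le (S ∪ T) {i, j}
    have h2 := Finset.card_union_le S T
    have h3 := Finset.card_le_two (a := i) (b := j)
    rw [Finset.card_compl, Fintype.card_fin]
    omega
  obtain ⟨k, hk, l, hl, hkl⟩ := Finset.one_lt_card.1 hcard
  simp only [Finset.mem_compl, Finset.mem_union, Finset.mem_insert, Finset.mem_singleton,
    not_or] at hk hl
  obtain ⟨⟨hkS, hkT⟩, hki, hkj⟩ := hk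
  obtain ⟨⟨hlS, hlT⟩, hli, hlj⟩ := hl
  have h1 := hQ k hkS
  have h2 := hQ l hlS
  have h3 := hR k hkT
  have h4 := hR l hlT
  rw [pderiv_pderiv_sumProduct hki] at h1
  rw [pderiv_pderiv_sumProduct hli] at h2
  rw [pderiv_pderiv_sumProduct hkj] at h3
  rw [pderiv_pderiv_sumProduct hlj] at h4
  have hminor :
      (summandDeriv F k - summandDeriv F l) * (summandDeriv F j - summandDeriv F i) = 0 := by
    linear_combination (summandDeriv F l + summandDeriv F j) * h1 -
      (summandDeriv F k + summandDeriv F j) * h2 + Q * pderiv k p * h4 - Q * pderiv l p * h3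
  rcases mul_eq_zero.1 hminor with h | h
  · exact summandDeriv_sub_ne_zero hkl h
  · exact summandDeriv_sub_ne_zero hij.symm h

theorem le_multiFormulaSize_mul_log {n D : ℕ} (hD : 2 * D + 4 ≤ n) :
    ((n * (D + 1) : ℕ) : ℝ) * Real.log 2 ≤
      (multiFormulaSize fun i : Fin n => pderiv i (sumProduct F n)) *
        Real.log (multiFormulaSize fun i : Fin n => pderiv i (sumProduct F n)) := by
  obtain ⟨Φ, hΦ, hs⟩ := exists_isMultiFormulaFor_size_eq
    fun i : Fin n => pderiv i (sumProduct F n)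
  rw [← hs]
  have := hΦ.card_mul_le D
    (fun i => lt_of_lt_of_le (by omega) (le_card_vars_pderiv_sumProduct i))
    (fun i j hij ⟨p, Q, R, S, T, hS, hT, hQ, hR⟩ =>
      not_gradients_parallel hij hD p Q R S T hS hT hQ hR)
  rwa [Fintype.card_fin] at this

/-- If the size is below `n²`, its logarithm is below `2 log n`, so that the bound on `s log s`
gives one on `s`. -/
theorem le_multiFormulaSize_pderiv_sumProduct {n : ℕ} (hn : 8 ≤ n) :
    Real.log 2 / 8 * ((n : ℝ) ^ 2 / Real.log n) ≤
      (multiFormulaSize fun i : Fin n => pderiv i (sumProduct F n) : ℕ) := by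
  have hn' : (8 : ℝ) ≤ n := by exact_mod_cast hn
  -- The largest `D` to which `not_gradients_parallel` applies.
  obtain ⟨D, hD1, hD2⟩ : ∃ D, 2 * D + 4 ≤ n ∧ n ≤ 4 * (D + 1) := ⟨(n - 4) / 2, by omega, by omega⟩
  have hmain := le_multiFormulaSize_mul_log (F := F) hD1
  set s := multiFormulaSize fun i : Fin n => pderiv i (sumProduct F n)
  have hlog2 : 0 < Real.log 2 := Real.log_pos one_lt_two
  have hlog2' : Real.log 2 ≤ 1 := by
    have := Real.log_two_lt_d9
    linarith
  have hlogn : 1 ≤ Real.log n := by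
    rw [Real.le_log_iff_exp_le (by linarith)]
    have := Real.exp_one_lt_d9
    linarith
  have hD2' : (n : ℝ) ≤ 4 * (D + 1) := by exact_mod_cast hD2
  have hq : (n : ℝ) ^ 2 / 4 * Real.log 2 ≤ s * Real.log s := by
    refine le_trans ?_ hmain
    push_cast
    have : (n : ℝ) ^ 2 / 4 ≤ n * (D + 1) := by nlinarith
    gcongr
  rw [mul_div_assoc', div_le_iff₀ (by linarith)]
  rcases le_or_gt (n ^ 2) s with h | h
  · have h' : (n : ℝ) ^ 2 ≤ s := by exact_mod_cast h
    have h0 : (0 : ℝ) ≤ (n : ℝ) ^ 2 := by positivity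
    nlinarith [mul_le_mul_of_nonneg_left hlogn (Nat.cast_nonneg (α := ℝ) s)]
  · have hs0 : (0 : ℝ) < s := by
      rcases Nat.eq_zero_or_pos s with h0 | h0
      · have : 0 < (n : ℝ) ^ 2 / 4 * Real.log 2 := by positivity
        rw [h0] at hq
        simp at hq
        linarith
      · exact_mod_cast h0
    have hls : Real.log s ≤ 2 * Real.log n := by
      rw [← Nat.cast_two, ← Real.log_pow]
      exact Real.log_le_log hs0 (by exact_mod_cast h.le)
    nlinarith [mul_le_mul_of_nonneg_left hls hs0.le]

end HardFamily

/-! ### Asymptotics -/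

/-- A function between `n / C` and `C n` is `n ^ (1 + o(1))`. -/
theorem exists_tendsto_zero_eq_rpow {L : ℕ → ℕ} {C : ℝ} (hC : 1 ≤ C)
    (hL : ∀ᶠ n : ℕ in atTop, (n : ℝ) / C ≤ L n ∧ (L n : ℝ) ≤ C * n) :
    ∃ ε : ℕ → ℝ, Tendsto ε atTop (𝓝 0) ∧
      ∀ᶠ n : ℕ in atTop, (L n : ℝ) = (n : ℝ) ^ (1 + ε n) := by
  have hlog : Tendsto (fun n : ℕ => Real.log n) atTop atTop :=
    Real.tendsto_log_atTop.comp tendsto_natCast_atTop_atTop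
  refine ⟨fun n => Real.log (L n) / Real.log n - 1, ?_, ?_⟩
  · have hto : Tendsto (fun n : ℕ => Real.log C / Real.log n) atTop (𝓝 0) :=
      tendsto_const_nhds.div_atTop hlog
    refine squeeze_zero_norm' ?_ hto
    filter_upwards [hL, eventually_gt_atTop 1] with n ⟨h1, h2⟩ hn
    have hn0 : (0 : ℝ) < n := by exact_mod_cast (by omega : 0 < n)
    have hlogn : 0 < Real.log n := Real.log_pos (by exact_mod_cast hn)
    have hL0 : (0 : ℝ) < L n := lt_of_lt_of_le (by positivity) h1
    have e1 : Real.log n - Real.log C ≤ Real.log (L n) := by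
      rw [← Real.log_div (by positivity) (by positivity)]
      exact Real.log_le_log (by positivity) h1
    have e2 : Real.log (L n) ≤ Real.log C + Real.log n := by
      rw [← Real.log_mul (by positivity) (by positivity)]
      exact Real.log_le_log hL0 h2
    rw [Real.norm_eq_abs, div_sub_one hlogn.ne', abs_div, abs_of_pos hlogn]
    gcongr
    rw [abs_le]
    constructor <;> linarith
  · filter_upwards [hL, eventually_gt_atTop 1] with n ⟨h1, h2⟩ hn
    have hn0 : (0 : ℝ) < n := by exact_mod_cast (by omega : 0 < n)
    have hlogn : 0 < Real.log n := Real.log_pos (by exact_mod_cast hn)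
    have hL0 : (0 : ℝ) < L n := lt_of_lt_of_le (by positivity) h1
    rw [add_sub_cancel, Real.rpow_def_of_pos hn0, mul_div_cancel₀ _ hlogn.ne', Real.exp_log hL0]

theorem mainTheorem10 (F : Type*) [Field F] [Infinite F] :
    (∃ f : (n : ℕ) → MvPolynomial (Fin n) F,
      (∃ ε : ℕ → ℝ, Tendsto ε atTop (𝓝 0) ∧
        ∀ᶠ n : ℕ in atTop, (formulaSize (f n) : ℝ) = (n : ℝ) ^ (1 + ε n)) ∧
      (∃ c : ℝ, 0 < c ∧ ∀ᶠ n : ℕ in atTop,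
        c * ((n : ℝ) ^ 2 / Real.log n) ≤
          (multiFormulaSize (fun i : Fin n => MvPolynomial.pderiv i (f n)) : ℝ))) ∧
    ¬ ∃ K : ℝ, ∀ (n : ℕ) (g : MvPolynomial (Fin n) F),
      (multiFormulaSize (fun i : Fin n => MvPolynomial.pderiv i g) : ℝ) ≤ K * formulaSize g := by
  have hlog2 : 0 < Real.log 2 := Real.log_pos one_lt_two
  refine ⟨⟨sumProduct F, exists_tendsto_zero_eq_rpow (C := 13) (by norm_num) ?_,
    Real.log 2 / 8, by positivity, ?_⟩, ?_⟩
  · filter_upwards [eventually_ge_atTop 2] with n hn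
    have h1 : (n : ℝ) ≤ formulaSize (sumProduct F n) := by
      exact_mod_cast le_formulaSize_sumProduct (F := F) hn
    have h2 : (formulaSize (sumProduct F n) : ℝ) ≤ ((10 * n + 3 : ℕ) : ℝ) := by
      exact_mod_cast formulaSize_sumProduct_le (F := F) n
    have hn' : (2 : ℝ) ≤ n := by exact_mod_cast hn
    push_cast at h2
    constructor
    · linarith
    · linarith
  · filter_upwards [eventually_ge_atTop 8] with n hn
    exact le_multiFormulaSize_pderiv_sumProduct hn
  · rintro ⟨K, hK⟩
    have hto : Tendsto (fun n : ℕ => Real.log n / n) atTop (𝓝 0) :=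
      (Real.isLittleO_log_id_atTop.tendsto_div_nhds_zero).comp tendsto_natCast_atTop_atTop
    have hpos : 0 < Real.log 2 / 8 / (13 * (|K| + 1)) := by positivity
    obtain ⟨n, hlt, hn⟩ := ((hto.eventually_lt_const hpos).and (eventually_ge_atTop 8)).exists
    have hn' : (8 : ℝ) ≤ n := by exact_mod_cast hn
    have hlogn : 0 < Real.log n := Real.log_pos (by linarith)
    have h1 := le_multiFormulaSize_pderiv_sumProduct (F := F) hn
    have h2 : (formulaSize (sumProduct F n) : ℝ) ≤ ((10 * n + 3 : ℕ) : ℝ) := by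
      exact_mod_cast formulaSize_sumProduct_le (F := F) n
    push_cast at h2
    have h3 := hK n (sumProduct F n)
    have h4 : K * formulaSize (sumProduct F n) ≤ (|K| + 1) * (13 * n) :=
      mul_le_mul (by linarith [le_abs_self K]) (by linarith) (Nat.cast_nonneg _) (by positivity)
    have h5 := h1.trans (h3.trans h4)
    rw [div_lt_div_iff₀ (by linarith) (by positivity)] at hlt
    rw [mul_div_assoc', div_le_iff₀ hlogn] at h5
    nlinarith
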